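/- A semiring here is a nonempty set $S$ with an associative and commutative addition and an associative (not necessarily commutative) multiplication satisfying both distributive laws; neither a zero nor a multiplicative identity is required. A set $A\subseteq S$ is thick in $(S,+)$ if for every finite $F\subseteq S$ there is $x\in S$ with $F+x\subseteq A$, and it is piecewise syndetic in $(S,+)$ if there is a finite $F\subseteq S$ such that $\bigcup_{s\in F}\{x\in S: s+x\in A\}$ is thick in $(S,+)$. **Theorem.** Let $S=(S,+,\cdot)$ be a semiring such that for every $s\in S$ the set $Ss=\{as: a\in S\}$ is piecewise syndetic in $(S,+)$. Let $k$ be a positive integer and let $S$ be coloured with two colours. Then there are $x,y\in S$ such that the set $$\{x,\;y,\;x+y\}\cup\{x^i y: 1\le i\le k\}$$ is monochromatic, or there are $x,y\in S$ such that the set $$\{x,\;y,\;xy\}\cup\{x+iy: 1\le i\le k\}$$ is monochromatic. -/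

import Mathlib

/-- `succPow x n = x ^ (n + 1)`, the positive powers of `x` (the multiplication need not have an
identity element). -/
def succPow {S : Type*} [Mul S] (x : S) : ℕ → S
  | 0 => x
  | n + 1 => succPow x n * x

/-- `succMultiple y n = (n + 1) y = y + ⋯ + y`, the positive multiples of `y` (the addition need not
have a neutral element). -/
def succMultiple {S : Type*} [Add S] (y : S) : ℕ → S
  | 0 => y
  | n + 1 => succMultiple y n + y

/-- `A` is thick in `(S, +)`: every finite set `F` has a translate `F + x` contained in `A`. -/
def IsAddThick {S : Type*} [Add S] (A : Set S) : Prop :=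
  ∀ F : Finset S, ∃ x : S, ∀ s ∈ F, s + x ∈ A

/-- `A` is piecewise syndetic in `(S, +)`: the union of finitely many of the sets
`-s + A = {x | s + x ∈ A}` is thick. -/
def IsAddPiecewiseSyndetic {S : Type*} [Add S] (A : Set S) : Prop :=
  ∃ F : Finset S, IsAddThick {x : S | ∃ s ∈ F, s + x ∈ A}

/-- All elements of `P` have the same color. -/
def IsMonochromatic {S : Type*} (c : S → Fin 2) (P : Set S) : Prop :=
  ∃ j : Fin 2, ∀ z ∈ P, c z = j

/-- The pattern `{x, y, x + y, x ^ i * y : 1 ≤ i ≤ k}`. -/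
def sumPowerPattern {S : Type*} [Add S] [Mul S] (k : ℕ) (x y : S) : Set S :=
  {x, y, x + y} ∪ {z | ∃ i < k, z = succPow x i * y}

/-- The pattern `{x, y, x * y, x + i y : 1 ≤ i ≤ k}`. -/
def productMultiplePattern {S : Type*} [Add S] [Mul S] (k : ℕ) (x y : S) : Set S :=
  {x, y, x * y} ∪ {z | ∃ i < k, z = x + succMultiple y i}

/-! Take a multiplicatively idempotent ultrafilter `p` all of whose members contain additive
finite-sum sets of every finite size. Let a be the colour that is `p`-large, b the other. If b is
not piecewise syndetic, fix y coloured a: the x that spoil `productMultiplePattern` cannot cover S.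
If, for every t, t·r has colour a for `p`-most r, then without a `sumPowerPattern` one generic
summand turns a into b and two turn b into a, which is contradictory. Otherwise b is piecewise
syndetic and some t·r has colour b for `p`-most r. `IsAddPiecewiseSyndetic.exists_return` gives y
and a piecewise syndetic D₀ inside b with D₀ + i(ty) inside b. Either (d, ty) works for some d in
D₀, or D₀·ty has colour a; then a second return, to D₀ along h, lets the colour of d·ty·h decide
between (d·ty, h) and (d, tyh). -/

open Filter Combinatorics

attribute [local instance] Ultrafilter.mul Ultrafilter.add Ultrafilter.semigroup
  Ultrafilter.addSemigroup

/-! ### Piecewise syndetic sets and finite-sum sets -/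

section Largeness

variable {S : Type*} [AddCommSemigroup S]

theorem IsAddThick.mono {A B : Set S} (hA : IsAddThick A) (h : A ⊆ B) : IsAddThick B :=
  fun F => (hA F).imp fun _ hx s hs => h (hx s hs)

theorem IsAddThick.inter_translates {A : Set S} (hA : IsAddThick A) (E : Finset S) :
    IsAddThick {x | ∀ e ∈ E, e + x ∈ A} := by
  classical
  intro F
  obtain ⟨x, hx⟩ := hA (Finset.image₂ (· + ·) E F)
  refine ⟨x, fun s hs e he => ?_⟩
  rw [← add_assoc]
  exact hx _ (Finset.mem_image₂_of_mem he hs)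

theorem IsAddThick.nonempty [Nonempty S] {A : Set S} (hA : IsAddThick A) : A.Nonempty := by
  obtain ⟨z⟩ := ‹Nonempty S›
  obtain ⟨x, hx⟩ := hA {z}
  exact ⟨_, hx z (Finset.mem_singleton_self z)⟩

theorem IsAddPiecewiseSyndetic.mono {A B : Set S} (hA : IsAddPiecewiseSyndetic A) (h : A ⊆ B) :
    IsAddPiecewiseSyndetic B :=
  hA.imp fun _ hF => hF.mono fun _ ⟨s, hs, hx⟩ => ⟨s, hs, h hx⟩

theorem IsAddPiecewiseSyndetic.nonempty [Nonempty S] {A : Set S}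
    (hA : IsAddPiecewiseSyndetic A) : A.Nonempty := by
  obtain ⟨F, hF⟩ := hA
  obtain ⟨x, s, -, hx⟩ := hF.nonempty
  exact ⟨_, hx⟩

theorem IsAddPiecewiseSyndetic.of_translates {A : Set S} {F : Finset S}
    (h : IsAddPiecewiseSyndetic {x | ∃ s ∈ F, s + x ∈ A}) : IsAddPiecewiseSyndetic A := by
  classical
  obtain ⟨G, hG⟩ := h
  refine ⟨Finset.image₂ (· + ·) F G, hG.mono ?_⟩
  rintro x ⟨g, hg, f, hf, hx⟩
  exact ⟨f + g, Finset.mem_image₂_of_mem hf hg, by rwa [add_assoc]⟩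

theorem IsAddPiecewiseSyndetic.of_translate {A : Set S} {s : S}
    (h : IsAddPiecewiseSyndetic {x | s + x ∈ A}) : IsAddPiecewiseSyndetic A :=
  .of_translates (F := {s}) (h.mono fun _ hx => ⟨s, Finset.mem_singleton_self s, hx⟩)

theorem IsAddThick.isAddPiecewiseSyndetic [Nonempty S] {A : Set S} (hA : IsAddThick A) :
    IsAddPiecewiseSyndetic A := by
  obtain ⟨z⟩ := ‹Nonempty S›
  refine ⟨{z}, (hA.inter_translates {z}).mono fun _ hx => ⟨z, ?_⟩⟩
  simpa using hx

/-- A finite set with no translate inside `A` must meet `B` whenever it is translated into `A ∪ B`.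
-/
theorem IsAddThick.or_of_union {A B : Set S} (h : IsAddThick (A ∪ B)) :
    IsAddThick A ∨ IsAddPiecewiseSyndetic B := by
  by_contra! hcon
  obtain ⟨hA, hB⟩ := hcon
  simp only [IsAddThick, not_forall, not_exists] at hA
  obtain ⟨G, hG⟩ := hA
  refine hB ⟨G, (h.inter_translates G).mono fun x hx => ?_⟩
  obtain ⟨s, hs, hsx⟩ := hG x
  exact ⟨s, hs, (hx s hs).resolve_left hsx⟩

theorem IsAddPiecewiseSyndetic.or_of_union {A B : Set S}
    (h : IsAddPiecewiseSyndetic (A ∪ B)) :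
    IsAddPiecewiseSyndetic A ∨ IsAddPiecewiseSyndetic B := by
  obtain ⟨F, hF⟩ := h
  have : IsAddThick ({x | ∃ s ∈ F, s + x ∈ A} ∪ {x | ∃ s ∈ F, s + x ∈ B}) :=
    hF.mono fun x ⟨s, hs, hx⟩ => hx.imp (fun h => ⟨s, hs, h⟩) (fun h => ⟨s, hs, h⟩)
  exact this.or_of_union.imp (fun h => ⟨F, h⟩) fun h => .of_translates h

theorem not_isAddPiecewiseSyndetic_empty [Nonempty S] :
    ¬ IsAddPiecewiseSyndetic (∅ : Set S) :=
  fun h => h.nonempty.ne_empty rfl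

theorem IsAddPiecewiseSyndetic.exists_of_iUnion [Nonempty S] {ι : Type*} [Finite ι]
    {A : ι → Set S} (h : IsAddPiecewiseSyndetic (⋃ i, A i)) :
    ∃ i, IsAddPiecewiseSyndetic (A i) := by
  classical
  cases nonempty_fintype ι
  have key : ∀ s : Finset ι, IsAddPiecewiseSyndetic (⋃ i ∈ s, A i) →
      ∃ i, IsAddPiecewiseSyndetic (A i) := by
    intro s
    induction s using Finset.induction_on with
    | empty => simpa using fun h => absurd h not_isAddPiecewiseSyndetic_empty
    | insert i s _ ih =>
      rw [Finset.set_biUnion_insert]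
      exact fun h => h.or_of_union.elim (fun h => ⟨i, h⟩) ih
  exact key Finset.univ (by simpa using h)

/-- `Y` contains all finite sums of some family of elements indexed by `ι`, for each finite `ι`. -/
def IsAddIPRich (Y : Set S) : Prop :=
  ∀ (ι : Type) [Fintype ι], ∃ h : ι → S, ∀ s : Finset ι, s.Nonempty →
    ∃ y ∈ Y, (y : WithZero S) = ∑ i ∈ s, (h i : WithZero S)

theorem exists_mem_FS_of_mem_FS_map_coe (a : Stream' S) {m : WithZero S}
    (hm : m ∈ Hindman.FS (a.map ((↑) : S → WithZero S))) :
    ∃ y ∈ Hindman.FS a, (y : WithZero S) = m := by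
  generalize hb : a.map ((↑) : S → WithZero S) = b at hm
  induction hm generalizing a with
  | head' b =>
    subst hb
    exact ⟨_, Hindman.FS.head a, rfl⟩
  | tail' b m _ ih =>
    subst hb
    obtain ⟨y, hy, rfl⟩ := ih a.tail rfl
    exact ⟨y, Hindman.FS.tail a y hy, rfl⟩
  | cons' b m _ ih =>
    subst hb
    obtain ⟨y, hy, rfl⟩ := ih a.tail rfl
    exact ⟨_, Hindman.FS.cons a y hy, rfl⟩

theorem IsAddIPRich.of_mem_idempotent {U : Ultrafilter S} (hU : U + U = U) {Y : Set S}
    (hY : Y ∈ U) : IsAddIPRich Y := by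
  classical
  intro ι _
  obtain ⟨a, ha⟩ := Hindman.exists_FS_of_large U hU Y hY
  let e : ι ↪ ℕ := (Fintype.equivFin ι).toEmbedding.trans Fin.valEmbedding
  refine ⟨fun i => a.get (e i), fun s hs => ?_⟩
  obtain ⟨y, hy, hys⟩ := exists_mem_FS_of_mem_FS_map_coe a
    (Hindman.FS.finsetSum (a.map ((↑) : S → WithZero S)) (s.map e) (hs.map))
  refine ⟨y, ha hy, ?_⟩
  rw [hys, Finset.sum_map]
  rfl

end Largeness

/-! ### A multiplicative idempotent with additively rich members -/

section Ultrafilters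

variable {S : Type*} [AddCommSemigroup S] [Semigroup S] [LeftDistribClass S]

/-- Left multiplication preserves finite sums; hence the ultrafilters with rich members are closed
under multiplication. -/
theorem IsAddIPRich.of_mul_left {Y : Set S} {m : S} (h : IsAddIPRich {y | m * y ∈ Y}) :
    IsAddIPRich Y := by
  intro ι _
  obtain ⟨f, hf⟩ := h ι
  refine ⟨fun i => m * f i, fun s hs => ?_⟩
  obtain ⟨y, hy, hys⟩ := hf s hs
  refine ⟨m * y, hy, ?_⟩
  let φ : WithZero S →+ WithZero S := WithZero.mapAddHom ⟨fun x => m * x, mul_add m⟩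
  have hφ : ∀ x : S, φ x = ((m * x : S) : WithZero S) := fun x => rfl
  rw [← hφ, hys, map_sum]
  rfl

/-- There is a multiplicatively idempotent ultrafilter all of whose members are rich in additive
finite sums sets. -/
theorem exists_mul_idempotent_ultrafilter_isAddIPRich [Nonempty S] :
    ∃ p : Ultrafilter S, p * p = p ∧ ∀ Y ∈ p, IsAddIPRich Y := by
  have hne : {p : Ultrafilter S | ∀ Y ∈ p, IsAddIPRich Y}.Nonempty := by
    obtain ⟨U, hU⟩ := exists_idempotent_of_compact_t2_of_continuous_add_left
      (@Ultrafilter.continuous_add_left S _)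
    exact ⟨U, fun Y hY => .of_mem_idempotent hU hY⟩
  have hclosed : IsClosed {p : Ultrafilter S | ∀ Y ∈ p, IsAddIPRich Y} := by
    have : {p : Ultrafilter S | ∀ Y ∈ p, IsAddIPRich Y} =
        ⋂ (Y : Set S) (_ : ¬ IsAddIPRich Y), {p | Yᶜ ∈ p} := by
      ext p
      simp only [Set.mem_ofPred_eq, Set.mem_iInter, Ultrafilter.compl_mem_iff_notMem]
      exact forall_congr' fun Y => not_imp_not.symm
    rw [this]
    exact isClosed_iInter fun Y => isClosed_iInter fun _ => ultrafilter_isClosed_basic _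
  obtain ⟨p, hp, hpp⟩ := exists_idempotent_in_compact_subsemigroup
    Ultrafilter.continuous_mul_left _ hne hclosed.isCompact fun p _ q hq Y hY => by
      obtain ⟨m, hm⟩ := ((Ultrafilter.eventually_mul p q (· ∈ Y)).1 hY).exists
      exact (hq _ hm).of_mul_left
  exact ⟨p, hpp, hp⟩

end Ultrafilters

/-! ### Multiple recurrence via Hales–Jewett -/

section Return

theorem Combinatorics.Line.sum_apply {α ι S M : Type*} [Fintype ι] [AddCommMonoid M]
    (l : Line α ι) (f : ι → S) (θ : α → S → M) (a₀ : α) (h₀ : ∀ x, θ a₀ x = 0) (a : α) :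
    ∑ j, θ (l a j) (f j) = ∑ j, θ (l a₀ j) (f j) + ∑ j with l.idxFun j = none, θ a (f j) := by
  rw [Finset.sum_filter, ← Finset.sum_add_distrib]
  refine Finset.sum_congr rfl fun j _ => ?_
  cases hj : l.idxFun j <;> simp [hj, h₀]

instance Combinatorics.Line.finite {α ι : Type*} [Finite α] [Finite ι] : Finite (Line α ι) :=
  Finite.of_injective Line.idxFun fun _ _ h => Line.ext h

/-- The translation of `S` by an element of `S` with a zero adjoined. -/
def withZeroVAdd {S : Type*} [Add S] (m : WithZero S) (x : S) : S :=
  WithZero.recZeroCoe x (fun y => y + x) m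

variable {S : Type*} [AddCommSemigroup S]

theorem withZeroVAdd_add (m n : WithZero S) (x : S) :
    withZeroVAdd (m + n) x = withZeroVAdd m (withZeroVAdd n x) := by
  cases m <;> cases n
  · rfl
  · rfl
  · rfl
  · exact add_assoc _ _ _

theorem withZeroVAdd_zero (x : S) : withZeroVAdd (0 : WithZero S) x = x := rfl

theorem withZeroVAdd_coe (y x : S) : withZeroVAdd (y : WithZero S) x = y + x := rfl

theorem coe_succMultiple (x : S) (n : ℕ) :
    ((succMultiple x n : S) : WithZero S) = (n + 1) • (x : WithZero S) := by
  induction n with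
  | zero => simp [succMultiple]
  | succ n ih => rw [succ_nsmul, ← ih]; rfl

variable [Semigroup S] [RightDistribClass S]

/-- Translate H into `S * s` up to shifts from G, writing g + e + x = a·s; one x' then brings all
the a into `D` up to shifts from F, and multiplying by `s` combines the two. -/
theorem IsAddPiecewiseSyndetic.image_mul_right
    (hS : ∀ s : S, IsAddPiecewiseSyndetic {t : S | ∃ a : S, t = a * s})
    {D : Set S} (hD : IsAddPiecewiseSyndetic D) (s : S) :
    IsAddPiecewiseSyndetic ((· * s) '' D) := by
  classical
  obtain ⟨F, hF⟩ := hD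
  obtain ⟨G, hG⟩ := hS s
  refine ⟨Finset.image₂ (fun f g => f * s + g) F G, fun H => ?_⟩
  obtain ⟨x, hx⟩ := hG H
  choose! g hg a ha using hx
  obtain ⟨x', hx'⟩ := hF (H.image a)
  refine ⟨x + x' * s, fun e he => ?_⟩
  obtain ⟨f, hf, hfD⟩ := hx' (a e) (Finset.mem_image_of_mem a he)
  refine ⟨f * s + g e, Finset.mem_image₂_of_mem hf (hg e he), _, hfD, ?_⟩
  simp only [add_mul, ← ha e he, add_assoc]

variable [LeftDistribClass S]

/-- Simultaneous multiple recurrence of a piecewise syndetic set `D` and of its image `D * s`, along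
a set which is rich in finite sums. -/
theorem IsAddPiecewiseSyndetic.exists_return [Nonempty S]
    (hS : ∀ s : S, IsAddPiecewiseSyndetic {t : S | ∃ a : S, t = a * s})
    {D : Set S} (hD : IsAddPiecewiseSyndetic D) {Y : Set S} (hY : IsAddIPRich Y) (s t : S)
    (k : ℕ) :
    ∃ h ∈ Y, IsAddPiecewiseSyndetic {d | d ∈ D ∧ ∀ i < k, d + succMultiple (t * h) i ∈ D ∧
      ∃ d' ∈ D, d' * s = d * s + succMultiple h i} := by
  classical
  obtain ⟨F, hF⟩ := hD
  obtain ⟨G, hG⟩ := hS s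
  obtain ⟨z⟩ := ‹Nonempty S›
  -- The letter `(i, true)` shifts d by (i + 1)·t·h, `(i, false)` shifts d·s by (i + 1)·h, and
  -- `none` is the base point. The colour of a word records its two syndeticity shifts.
  obtain ⟨ι, _, hHJ⟩ := Line.exists_mono_in_high_dimension (Option (Fin k × Bool)) (F × G)
  obtain ⟨h, hh⟩ := hY ι
  let τ : WithZero S →+ WithZero S := WithZero.mapAddHom ⟨fun x => t * x, mul_add t⟩
  have hτ : ∀ x : S, τ x = ((t * x : S) : WithZero S) := fun x => rfl
  let u : Option (Fin k × Bool) → WithZero S → WithZero S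
    | none, _ => 0
    | some (i, true), x => (i.1 + 1) • τ x
    | some (_, false), _ => 0
  let v : Option (Fin k × Bool) → WithZero S → WithZero S
    | none, _ => 0
    | some (_, true), _ => 0
    | some (i, false), x => (i.1 + 1) • x
  let U : (ι → Option (Fin k × Bool)) → WithZero S := fun w => ∑ j, u (w j) (h j)
  let V : (ι → Option (Fin k × Bool)) → WithZero S := fun w => ∑ j, v (w j) (h j)
  obtain ⟨x, hx⟩ := hG (Finset.univ.image fun w => withZeroVAdd (V w) z)
  -- The choices depend on the value of `V w` on z, not on `w`, so letters `(i, true)`, which leave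
  -- `V` fixed, do not change a. Other y get a dummy value.
  have hx' : ∀ y : S, ∃ g ∈ G, ∃ a : S, (∃ w, withZeroVAdd (V w) z = y) → g + (y + x) = a * s := by
    intro y
    by_cases hy : ∃ w, withZeroVAdd (V w) z = y
    · obtain ⟨w, rfl⟩ := hy
      obtain ⟨g, hg, a, ha⟩ := hx _ (Finset.mem_image_of_mem _ (Finset.mem_univ w))
      exact ⟨g, hg, a, fun _ => ha⟩
    · obtain ⟨g, hg, -⟩ := hx _ (Finset.mem_image_of_mem _ (Finset.mem_univ fun _ => none))
      exact ⟨g, hg, z, fun hw => absurd hw hy⟩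
  choose g hg a ha using hx'
  replace ha : ∀ w, g (withZeroVAdd (V w) z) + (withZeroVAdd (V w) z + x) =
    a (withZeroVAdd (V w) z) * s := fun w => ha _ ⟨w, rfl⟩
  let e : (ι → Option (Fin k × Bool)) → S :=
    fun w => withZeroVAdd (U w) (a (withZeroVAdd (V w) z))
  have hX := (hF.inter_translates (Finset.univ.image e)).isAddPiecewiseSyndetic
  have hr : ∀ l : Line (Option (Fin k × Bool)) ι, ∃ y ∈ Y,
      (y : WithZero S) = ∑ j with l.idxFun j = none, (h j : WithZero S) := by
    intro l
    obtain ⟨j, hj⟩ := l.proper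
    exact hh _ ⟨j, by simpa using hj⟩
  choose r hrY hr using hr
  let R : S → Set S := fun h => {d | d ∈ D ∧ ∀ i < k, d + succMultiple (t * h) i ∈ D ∧
      ∃ d' ∈ D, d' * s = d * s + succMultiple h i}
  -- The line depends on x', but there are finitely many lines, so a single one serves a piecewise
  -- syndetic set.
  suffices hsub : {x' | ∀ y ∈ Finset.univ.image e, y + x' ∈ {x | ∃ f ∈ F, f + x ∈ D}} ⊆
      ⋃ l, {x' | e (l none) + x' ∈ {x | ∃ f ∈ F, f + x ∈ R (r l)}} by
    obtain ⟨l, hl⟩ := (hX.mono hsub).exists_of_iUnion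
    exact ⟨r l, hrY l, hl.of_translate.of_translates⟩
  intro x' hx'
  have hx'' : ∀ w, ∃ f ∈ F, f + (e w + x') ∈ D :=
    fun w => hx' _ (Finset.mem_image_of_mem e (Finset.mem_univ w))
  choose f hfF hfD using hx''
  obtain ⟨l, ⟨f₀, g₀⟩, hl⟩ := hHJ fun w => (⟨f w, hfF w⟩, ⟨g (withZeroVAdd (V w) z), hg _⟩)
  simp only [Prod.ext_iff, Subtype.ext_iff] at hl
  have hUnone : ∀ b, U (l b) = U (l none) + ∑ j with l.idxFun j = none, u b (h j) :=
    fun b => l.sum_apply h (fun b x => u b x) none (fun _ => rfl) b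
  have hVnone : ∀ b, V (l b) = V (l none) + ∑ j with l.idxFun j = none, v b (h j) :=
    fun b => l.sum_apply h (fun b x => v b x) none (fun _ => rfl) b
  have hD : ∀ b, (f₀ : S) + (e (l b) + x') ∈ D := fun b => by
    rw [← (hl b).1]
    exact hfD _
  refine Set.mem_iUnion.2 ⟨l, f₀, f₀.2, hD none, fun i hi => ⟨?_, ?_⟩⟩
  · have hU : U (l (some (⟨i, hi⟩, true))) =
        (succMultiple (t * r l) i : S) + U (l none) := by
      rw [hUnone, add_comm]
      congr 1
      simp only [u]
      rw [← Finset.smul_sum, ← map_sum, ← hr, hτ, coe_succMultiple]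
    have hV : V (l (some (⟨i, hi⟩, true))) = V (l none) := by
      rw [hVnone]
      simp [v]
    have := hD (some (⟨i, hi⟩, true))
    simp only [e, hU, hV, withZeroVAdd_add, withZeroVAdd_coe] at this
    convert this using 1
    simp only [e]
    ac_rfl
  · have hU : U (l (some (⟨i, hi⟩, false))) = U (l none) := by
      rw [hUnone]
      simp [u]
    have hV : V (l (some (⟨i, hi⟩, false))) = (succMultiple (r l) i : S) + V (l none) := by
      rw [hVnone, add_comm]
      congr 1
      simp only [v]
      rw [← Finset.smul_sum, ← hr, coe_succMultiple]
    refine ⟨_, hD (some (⟨i, hi⟩, false)), ?_⟩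
    have h1 := ha (l none)
    have h2 := ha (l (some (⟨i, hi⟩, false)))
    rw [(hl _).2] at h1 h2
    have h3 : a (withZeroVAdd (V (l (some (⟨i, hi⟩, false)))) z) * s =
        succMultiple (r l) i + a (withZeroVAdd (V (l none)) z) * s := by
      rw [← h1, ← h2, hV, withZeroVAdd_add, withZeroVAdd_coe]
      ac_rfl
    simp only [e, hU, add_mul]
    cases hUl : U (l none)
    · simp only [withZeroVAdd_zero, h3]
      ac_rfl
    · simp only [withZeroVAdd_coe, add_mul, h3]
      ac_rfl

end Return

/-! ### Finding one of the two patterns -/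

section Patterns

variable {S : Type*} [AddCommSemigroup S] [Semigroup S]

theorem isMonochromatic_sumPowerPattern {c : S → Fin 2} {k : ℕ} {x y : S} {j : Fin 2}
    (hx : c x = j) (hy : c y = j) (hxy : c (x + y) = j)
    (h : ∀ i < k, c (succPow x i * y) = j) : IsMonochromatic c (sumPowerPattern k x y) := by
  refine ⟨j, ?_⟩
  rintro z ((rfl | rfl | rfl) | ⟨i, hi, rfl⟩)
  exacts [hx, hy, hxy, h i hi]

theorem isMonochromatic_productMultiplePattern {c : S → Fin 2} {k : ℕ} {x y : S} {j : Fin 2}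
    (hx : c x = j) (hy : c y = j) (hxy : c (x * y) = j)
    (h : ∀ i < k, c (x + succMultiple y i) = j) :
    IsMonochromatic c (productMultiplePattern k x y) := by
  refine ⟨j, ?_⟩
  rintro z ((rfl | rfl | rfl) | ⟨i, hi, rfl⟩)
  exacts [hx, hy, hxy, h i hi]

theorem exists_productMultiplePattern_of_not_isAddPiecewiseSyndetic [RightDistribClass S]
    [Nonempty S]
    (hS : ∀ s : S, IsAddPiecewiseSyndetic {t : S | ∃ a : S, t = a * s})
    {c : S → Fin 2} {k : ℕ} {a b : Fin 2} (hc : ∀ z, c z = a ∨ c z = b) {y : S} (hy : c y = a)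
    (hb : ¬ IsAddPiecewiseSyndetic {z | c z = b}) :
    ∃ x y : S, IsMonochromatic c (productMultiplePattern k x y) := by
  refine by_contra fun hno => ?_
  have hcov : IsAddPiecewiseSyndetic ({x | c x = b} ∪ {x | c (x * y) = b} ∪
      ⋃ i : Fin k, {x | c (succMultiple y i + x) = b}) := by
    have huniv : IsAddThick (Set.univ : Set S) := fun F => ⟨y, fun _ _ => trivial⟩
    refine huniv.isAddPiecewiseSyndetic.mono fun x _ => ?_
    by_contra hx
    simp only [Set.mem_union, Set.mem_iUnion, Set.mem_ofPred_eq, not_or, not_exists] at hx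
    refine hno ⟨x, y, isMonochromatic_productMultiplePattern ((hc _).resolve_right hx.1.1) hy
      ((hc _).resolve_right hx.1.2) fun i hi => ?_⟩
    rw [add_comm]
    exact (hc _).resolve_right (hx.2 ⟨i, hi⟩)
  rcases hcov.or_of_union with h | h
  · rcases h.or_of_union with h | h
    · exact hb h
    · refine hb ((h.image_mul_right hS y).mono ?_)
      rintro _ ⟨x, hx, rfl⟩
      exact hx
  · obtain ⟨i, hi⟩ := h.exists_of_iUnion
    exact hb (.of_translate (s := succMultiple y i) hi)

variable [LeftDistribClass S]

/-- If one color is `p`-large together with all its left dilates, then one of the two patterns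
is monochromatic. -/
theorem exists_pattern_of_forall_eventually_mul [Nonempty S] {c : S → Fin 2} {k : ℕ} {a b : Fin 2}
    (hab : a ≠ b) (hc : ∀ z, c z = a ∨ c z = b) (p : Ultrafilter S)
    (hp : ∀ᶠ r in p, c r = a) (ht : ∀ t, ∀ᶠ r in p, c (t * r) = a) :
    (∃ x y : S, IsMonochromatic c (sumPowerPattern k x y)) ∨
      (∃ x y : S, IsMonochromatic c (productMultiplePattern k x y)) := by
  by_cases hb : ∃ z, c z = b
  swap
  · push Not at hb
    obtain ⟨z⟩ := ‹Nonempty S›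
    have ha : ∀ z, c z = a := fun z => (hc z).resolve_right (hb z)
    exact .inl ⟨z, z, isMonochromatic_sumPowerPattern (ha _) (ha _) (ha _) fun _ _ => ha _⟩
  refine .inl ?_
  by_contra hno
  have hno' : ∀ x y j, c x = j → c y = j → (∀ i < k, c (succPow x i * y) = j) → c (x + y) ≠ j :=
    fun x y j h1 h2 h3 h4 => hno ⟨x, y, isMonochromatic_sumPowerPattern h1 h2 h4 h3⟩
  have hpow : ∀ x t, ∀ᶠ r in p, ∀ i < k, c (succPow x i * (t * r)) = a := fun x t => by
    have : ∀ᶠ r in p, ∀ i ∈ Finset.range k, c (succPow x i * (t * r)) = a :=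
      (Finset.eventually_all _).2 fun i _ => by
        simpa only [mul_assoc] using ht (succPow x i * t)
    simpa using this
  have hpow' : ∀ x, ∀ᶠ r in p, ∀ i < k, c (succPow x i * r) = a := fun x => by
    have : ∀ᶠ r in p, ∀ i ∈ Finset.range k, c (succPow x i * r) = a :=
      (Finset.eventually_all _).2 fun i _ => ht (succPow x i)
    simpa using this
  have hadd : ∀ x, c x = a → ∀ᶠ r in p, c (x + r) = b := fun x hx => by
    filter_upwards [hp, hpow' x] with r h1 h2
    exact (hc _).resolve_left (hno' x r a hx h1 h2)
  have hadd' : ∀ x t, c x = a → ∀ᶠ r in p, c (x + t * r) = b := fun x t hx => by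
    filter_upwards [ht t, hpow x t] with r h1 h2
    exact (hc _).resolve_left (hno' x (t * r) a hx h1 h2)
  -- Here x + y and all z^i·x + z^i·y have colour b, so z + (x + y) cannot.
  have hadd2 : ∀ z, c z = b → ∀ᶠ x in p, ∀ᶠ y in p, c (z + (x + y)) = a := fun z hz => by
    filter_upwards [hp, hpow' z] with x h1 h2
    have : ∀ᶠ y in p, ∀ i ∈ Finset.range k, c (succPow z i * x + succPow z i * y) = b :=
      (Finset.eventually_all _).2 fun i hi => hadd' _ _ (h2 i (by simpa using hi))
    filter_upwards [hadd x h1, this] with y h3 h4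
    refine (hc _).resolve_right (hno' z (x + y) b hz h3 fun i hi => ?_)
    rw [mul_add]
    exact h4 i (by simpa using hi)
  obtain ⟨z, hz⟩ := hb
  obtain ⟨x, hx⟩ := (hadd2 z hz).exists
  -- If z + x is a, one more summand must give both a and b. If it is b, then z + x + y is a, and a
  -- further w gives the same clash.
  rcases hc (z + x) with h | h
  · obtain ⟨y, h1, h2⟩ := (hx.and (hadd _ h)).exists
    rw [add_assoc] at h2
    exact hab (h1.symm.trans h2)
  · obtain ⟨y, h1, h2⟩ := (hx.and (hadd2 _ h)).exists
    obtain ⟨w, h3, h4⟩ := (h2.and (hadd _ h1)).exists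
    refine hab (h3.symm.trans (Eq.trans ?_ h4))
    simp only [add_assoc]

theorem exists_productMultiplePattern_of_eventually_mul [RightDistribClass S] [Nonempty S]
    (hS : ∀ s : S, IsAddPiecewiseSyndetic {t : S | ∃ a : S, t = a * s})
    {c : S → Fin 2} {k : ℕ} {a b : Fin 2} (hc : ∀ z, c z = a ∨ c z = b) {p : Ultrafilter S}
    (hpp : p * p = p) (hrich : ∀ Y ∈ p, IsAddIPRich Y) (hp : ∀ᶠ r in p, c r = a)
    (hb : IsAddPiecewiseSyndetic {z | c z = b}) {t : S} (ht : ∀ᶠ r in p, c (t * r) = b) :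
    ∃ x y : S, IsMonochromatic c (productMultiplePattern k x y) := by
  -- Idempotence lets y be chosen first so that t·y·h is still b for `p`-most h.
  have ht2 : ∀ᶠ y in p, ∀ᶠ h in p, c (t * (y * h)) = b := by
    rwa [← Ultrafilter.eventually_mul p p fun r => c (t * r) = b, hpp]
  obtain ⟨y, ⟨hy1, hy2⟩, hD⟩ := hb.exists_return hS (hrich _ (ht.and ht2)) t t k
  set D₀ := {d | d ∈ {z | c z = b} ∧ ∀ i < k, d + succMultiple (t * y) i ∈ {z | c z = b} ∧
    ∃ d' ∈ {z | c z = b}, d' * t = d * t + succMultiple y i}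
  by_cases hex : ∃ d ∈ D₀, c (d * (t * y)) = b
  · obtain ⟨d, hd, hdy⟩ := hex
    exact ⟨d, t * y, isMonochromatic_productMultiplePattern hd.1 hy1 hdy fun i hi => (hd.2 i hi).1⟩
  push Not at hex
  replace hex : ∀ d ∈ D₀, c (d * (t * y)) = a := fun d hd => (hc _).resolve_right (hex d hd)
  obtain ⟨h, ⟨hh1, hh2⟩, hD'⟩ := hD.exists_return hS (hrich _ (hp.and hy2)) (t * y) (t * y) k
  obtain ⟨d, hd, hdi⟩ := hD'.nonempty
  rcases hc (d * (t * y) * h) with hdh | hdh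
  · refine ⟨d * (t * y), h, isMonochromatic_productMultiplePattern (hex d hd) hh1 hdh
      fun i hi => ?_⟩
    obtain ⟨d', hd', he⟩ := (hdi i hi).2
    rw [← he]
    exact hex d' hd'
  · refine ⟨d, t * y * h, isMonochromatic_productMultiplePattern hd.1 ?_ ?_
      fun i hi => (hdi i hi).1.1⟩
    · rw [mul_assoc]
      exact hh2
    · rw [← mul_assoc]
      exact hdh

end Patterns

theorem mainTheorem5 {S : Type*} [Nonempty S] [AddCommSemigroup S] [Semigroup S]
    [LeftDistribClass S] [RightDistribClass S]
    (hS : ∀ s : S, IsAddPiecewiseSyndetic {t : S | ∃ a : S, t = a * s})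
    (k : ℕ) (hk : 0 < k) (c : S → Fin 2) :
    (∃ x y : S, IsMonochromatic c (sumPowerPattern k x y)) ∨
      (∃ x y : S, IsMonochromatic c (productMultiplePattern k x y)) := by
  obtain ⟨p, hpp, hrich⟩ := exists_mul_idempotent_ultrafilter_isAddIPRich (S := S)
  obtain ⟨a, b, hab, hc, hp⟩ : ∃ a b : Fin 2, a ≠ b ∧ (∀ z, c z = a ∨ c z = b) ∧
      ∀ᶠ r in p, c r = a := by
    have hfin : ∀ j : Fin 2, j = 0 ∨ j = 1 := by decide
    rcases Ultrafilter.eventually_or.1 (Eventually.of_forall (f := (p : Filter S))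
      fun z => hfin (c z)) with h | h
    · exact ⟨0, 1, by decide, fun z => hfin (c z), h⟩
    · exact ⟨1, 0, by decide, fun z => (hfin (c z)).symm, h⟩
  by_cases hb : IsAddPiecewiseSyndetic {z | c z = b}
  swap
  · obtain ⟨y, hy⟩ := hp.exists
    exact .inr (exists_productMultiplePattern_of_not_isAddPiecewiseSyndetic hS hc hy hb)
  by_cases ht : ∀ t, ∀ᶠ r in p, c (t * r) = a
  · exact exists_pattern_of_forall_eventually_mul hab hc p hp ht
  · push Not at ht
    obtain ⟨t, ht⟩ := ht
    have ht' : ∀ᶠ r in p, c (t * r) = b := by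
      filter_upwards [ht] with r hr
      exact (hc _).resolve_left hr
    exact .inr (exists_productMultiplePattern_of_eventually_mul hS hc hpp hrich hp hb ht')
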